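/- Assume $\mathsf{GCH}$, i.e. $2^{\kappa}=\kappa^{+}$ for every infinite cardinal $\kappa$. Let $\mathbb{C}=\mathrm{Clop}(2^{\omega})$ be the Cantor algebra, i.e. the Boolean algebra of clopen subsets of the Cantor space, and let $\mathbb{M}_{\omega_2}=\mathrm{Bor}(\{0,1\}^{\omega_2})/_{\lambda_{\omega_2}=0}$ be the quotient of the Boolean algebra of Borel subsets of $\{0,1\}^{\omega_2}$ by the ideal of null sets of the standard product (Haar) probability measure $\lambda_{\omega_2}$. Let $(\varphi_\alpha)_{\alpha<\omega_2}$ be a family of Boolean homomorphisms $\varphi_\alpha\colon\mathbb{C}\to\mathbb{M}_{\omega_2}$. Then there are $\alpha<\beta<\omega_2$ and a Boolean automorphism $\Phi\colon\mathbb{M}_{\omega_2}\to\mathbb{M}_{\omega_2}$ such that $\Phi(\varphi_\alpha(C))=\varphi_\beta(C)$ and $\Phi(\varphi_\beta(C))=\varphi_\alpha(C)$ for every $C\in\mathbb{C}$. -/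

import Mathlib

open MeasureTheory Cardinal
open scoped ENNReal

/-- The generalized continuum hypothesis: `2 ^ c = c⁺` for every infinite cardinal `c`. -/
def GCH : Prop := ∀ c : Cardinal.{0}, ℵ₀ ≤ c → (2 : Cardinal.{0}) ^ c = Order.succ c

/-- The Cantor algebra: the Boolean algebra of clopen subsets of the Cantor space. -/
abbrev CantorAlgebra : Type := TopologicalSpace.Clopens (ℕ → Bool)

/-- The generalized Cantor cube `{0,1}^κ`, as a compact topological group (addition mod 2). -/
def CantorCube (κ : Type) : Type := κ → ZMod 2

namespace CantorCube

variable (κ : Type)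

instance : AddCommGroup (CantorCube κ) := inferInstanceAs (AddCommGroup (κ → ZMod 2))

/-- The product topology, `{0,1}` being discrete. -/
instance : TopologicalSpace (CantorCube κ) := inferInstanceAs (TopologicalSpace (κ → ZMod 2))

instance : IsTopologicalAddGroup (CantorCube κ) :=
  inferInstanceAs (IsTopologicalAddGroup (κ → ZMod 2))

instance : CompactSpace (CantorCube κ) := inferInstanceAs (CompactSpace (κ → ZMod 2))

instance : T2Space (CantorCube κ) := inferInstanceAs (T2Space (κ → ZMod 2))

/-- All Borel sets of the product topology are measurable. For uncountable `κ` this is more than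
the product `σ`-algebra. -/
instance : MeasurableSpace (CantorCube κ) := borel (CantorCube κ)

instance : BorelSpace (CantorCube κ) := ⟨rfl⟩

/-- The standard product measure on the Borel subsets of `{0,1}^κ`: the regular Borel probability
measure that is invariant under translations. Its values on the basic clopen sets are computed in
`CantorCube.lam_cylinder`. -/
noncomputable def lam : Measure (CantorCube κ) :=
  Measure.addHaarMeasure (⊤ : TopologicalSpace.PositiveCompacts (CantorCube κ))

instance : (lam κ).IsAddHaarMeasure :=
  inferInstanceAs (Measure.addHaarMeasure _).IsAddHaarMeasure

instance : (lam κ).Regular := inferInstanceAs (Measure.addHaarMeasure _).Regular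

instance : IsProbabilityMeasure (lam κ) :=
  ⟨Measure.addHaarMeasure_self (K₀ := (⊤ : TopologicalSpace.PositiveCompacts (CantorCube κ)))⟩

variable {κ}

/-- The measure of a basic clopen set that fixes `n` coordinates is `2⁻ⁿ`. -/
theorem lam_cylinder (s : Finset κ) (e : κ → ZMod 2) :
    lam κ {x | ∀ i ∈ s, x i = e i} = (2⁻¹ : ℝ≥0∞) ^ s.card := by
  classical
  induction s using Finset.induction_on with
  | empty => simp
  | insert a s ha ih =>
    have hcyl : ∀ d : κ → ZMod 2, IsOpen {x : CantorCube κ | ∀ i ∈ insert a s, x i = d i} := by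
      intro d
      have : {x : CantorCube κ | ∀ i ∈ insert a s, x i = d i}
          = Set.pi (↑(insert a s) : Set κ) (fun i => {d i}) := by
        ext x; exact Iff.rfl
      rw [this]
      exact isOpen_set_pi (insert a s).finite_toSet fun i _ => isOpen_discrete _
    let t : CantorCube κ := (Pi.single a 1 : κ → ZMod 2)
    have hta : t a = 1 := by simp [t]
    have htn : ∀ i ∈ s, t i = 0 := by
      intro i hi
      have : i ≠ a := by rintro rfl; exact ha hi
      simp [t, this]
    have hadd : ∀ x i, (t + x) i = t i + x i := fun _ _ => rfl
    have two : ∀ u v : ZMod 2, (1 + u = v) ↔ u ≠ v := by decide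
    set A : Set (CantorCube κ) := {x | ∀ i ∈ insert a s, x i = e i} with hA
    have hun : {x : CantorCube κ | ∀ i ∈ s, x i = e i} = A ∪ (fun x => t + x) ⁻¹' A := by
      ext x
      simp only [hA, Set.mem_ofPred_eq, Set.mem_union, Set.mem_preimage, Finset.forall_mem_insert,
        hadd, hta, two]
      have : (∀ i ∈ s, t i + x i = e i) ↔ ∀ i ∈ s, x i = e i :=
        forall₂_congr fun i hi => by rw [htn i hi, zero_add]
      rw [this]
      tauto
    have hdis : Disjoint A ((fun x => t + x) ⁻¹' A) := by
      rw [Set.disjoint_left]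
      intro x hx hx'
      have h1 := hx a (Finset.mem_insert_self a s)
      have h2 : (t + x) a = e a := hx' a (Finset.mem_insert_self a s)
      rw [hadd, hta, two] at h2
      exact h2 h1
    rw [hun, measure_union hdis ((hcyl e).measurableSet.preimage (measurable_const_add t)),
      measure_preimage_add, ← two_mul] at ih
    rw [Finset.card_insert_of_notMem ha, pow_succ, ← ih, mul_comm, ← mul_assoc,
      ENNReal.inv_mul_cancel two_ne_zero ENNReal.ofNat_ne_top, one_mul]

end CantorCube

/-- Two measurable sets are identified when they differ by a null set. -/
def measureAlgebraSetoid {X : Type} [MeasurableSpace X] (μ : Measure X) :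
    Setoid {s : Set X // MeasurableSet s} where
  r s t := (s : Set X) =ᵐ[μ] (t : Set X)
  iseqv := ⟨fun _ => Filter.EventuallyEq.rfl, fun h => h.symm, fun h h' => h.trans h'⟩

/-- The quotient of the Boolean algebra of measurable sets by the ideal of null sets. -/
def MeasureQuotient {X : Type} [MeasurableSpace X] (μ : Measure X) : Type :=
  Quotient (measureAlgebraSetoid μ)

namespace MeasureQuotient

variable {X : Type} [MeasurableSpace X] {μ : Measure X}

/-- The class of a measurable set. -/
def mk (μ : Measure X) (s : {s : Set X // MeasurableSet s}) : MeasureQuotient μ :=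
  Quotient.mk (measureAlgebraSetoid μ) s

theorem mk_eq_mk {s t : {s : Set X // MeasurableSet s}} :
    mk μ s = mk μ t ↔ (s : Set X) =ᵐ[μ] (t : Set X) :=
  Quotient.eq (r := measureAlgebraSetoid μ)

instance : LE (MeasureQuotient μ) where
  le := Quotient.lift₂ (fun s t => (s : Set X) ≤ᵐ[μ] (t : Set X)) fun _ _ _ _ h h' =>
    propext ⟨fun k => h.symm.le.trans (k.trans h'.le), fun k => h.le.trans (k.trans h'.symm.le)⟩

instance : Max (MeasureQuotient μ) where
  max := Quotient.map₂ (fun s t => ⟨s ∪ t, s.2.union t.2⟩) fun _ _ h _ _ h' => ae_eq_set_union h h'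

instance : Min (MeasureQuotient μ) where
  min := Quotient.map₂ (fun s t => ⟨s ∩ t, s.2.inter t.2⟩) fun _ _ h _ _ h' => ae_eq_set_inter h h'

instance : Compl (MeasureQuotient μ) where
  compl := Quotient.map (fun s => ⟨(s : Set X)ᶜ, s.2.compl⟩) fun _ _ h => ae_eq_set_compl_compl.2 h

instance : Top (MeasureQuotient μ) := ⟨mk μ ⟨Set.univ, MeasurableSet.univ⟩⟩

instance : Bot (MeasureQuotient μ) := ⟨mk μ ⟨∅, MeasurableSet.empty⟩⟩

theorem mk_le_mk {s t : {s : Set X // MeasurableSet s}} :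
    mk μ s ≤ mk μ t ↔ (s : Set X) ≤ᵐ[μ] (t : Set X) := Iff.rfl

theorem ind {p : MeasureQuotient μ → Prop} (h : ∀ s, p (mk μ s)) (a : MeasureQuotient μ) : p a :=
  Quotient.ind h a

instance : BooleanAlgebra (MeasureQuotient μ) where
  le_refl := ind fun _ => Filter.EventuallyLE.rfl
  le_trans := ind fun _ => ind fun _ => ind fun _ => fun h h' => Filter.EventuallyLE.trans h h'
  le_antisymm := ind fun _ => ind fun _ => fun h h' => mk_eq_mk.2 (Filter.EventuallyLE.antisymm h h')
  sup := max
  inf := min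
  le_sup_left := ind fun s => ind fun t => (Set.subset_union_left (s := s.1) (t := t.1)).eventuallyLE
  le_sup_right :=
    ind fun s => ind fun t => (Set.subset_union_right (s := s.1) (t := t.1)).eventuallyLE
  sup_le := ind fun s => ind fun t => ind fun u => fun h h' => by
    refine mk_le_mk.2 ?_
    filter_upwards [mk_le_mk.1 h, mk_le_mk.1 h'] with x hx hx'
    exact fun k => k.elim hx hx'
  inf_le_left := ind fun s => ind fun t => (Set.inter_subset_left (s := s.1) (t := t.1)).eventuallyLE
  inf_le_right :=
    ind fun s => ind fun t => (Set.inter_subset_right (s := s.1) (t := t.1)).eventuallyLE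
  le_inf := ind fun s => ind fun t => ind fun u => fun h h' => by
    refine mk_le_mk.2 ?_
    filter_upwards [mk_le_mk.1 h, mk_le_mk.1 h'] with x hx hx'
    exact fun k => ⟨hx k, hx' k⟩
  le_sup_inf := ind fun s => ind fun t => ind fun u =>
    (Set.union_inter_distrib_left s.1 t.1 u.1).symm.subset.eventuallyLE
  inf_compl_le_bot := ind fun s => (Set.inter_compl_self s.1).subset.eventuallyLE
  top_le_sup_compl := ind fun s => (Set.union_compl_self s.1).symm.subset.eventuallyLE
  le_top := ind fun s => (Set.subset_univ s.1).eventuallyLE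
  bot_le := ind fun s => (Set.empty_subset s.1).eventuallyLE

end MeasureQuotient

/-- The measure algebra `𝕄_κ = Bor({0,1}^κ) / {λ_κ = 0}`. -/
abbrev MeasureAlg (κ : Type) : Type := MeasureQuotient (CantorCube.lam κ)

/-! By regularity of Haar measure each Borel set is, up to a null set, a Borel condition on
countably many coordinates. `CantorAlgebra` is countable, so each `φ α` is coded by one injective
sequence `f α` of coordinates and one family `B α` of Borel subsets of `CantorCube ℕ`; there are at
most `𝔠` such families, and `𝔠 = ℵ₁ < ℵ₂`. A closure argument finds two indices with the same `B`
whose sequences meet only at equal positions. Exchanging `f α n` with `f β n` is then an involution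
of the coordinates, and it induces the automorphism. -/

/-! ### A pair of injective sequences meeting only at equal indices -/

/-- Among more than continuum many injective sequences, coloured with at most continuum many
colours, there are two of the same colour whose common values occur at the same indices. -/
theorem exists_ne_forall_eq_imp_index_eq {ι κ T : Type} (hι : 𝔠 < #ι) (hT : #T ≤ 𝔠)
    (f : ι → ℕ → κ) (hf : ∀ a, Function.Injective (f a)) (t : ι → T) :
    ∃ a b, a ≠ b ∧ t a = t b ∧ ∀ n m, f a n = f b m → n = m := by
  classical
  have : Nonempty ι := mk_ne_zero_iff.1 (ne_bot_of_gt hι)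
  -- `M`, the range of `ev`, has at most continuum many elements, and every restriction of some
  -- `f b` with values among those of the `f a`, `a ∈ M`, extends to some `f a`, `a ∈ M`.
  let A : Type := (Set ℕ × (ℕ → ℕ)) × T
  let step : (Σ a : A, (a.1.1 → ι)) → ι := fun x =>
    if h : ∃ b, t b = x.1.2 ∧ ∀ n : x.1.1.1, f b n = f (x.2 n) (x.1.1.2 n) then h.choose
    else Classical.arbitrary ι
  -- Well-founded trees with countable branching: evaluating them by `step` closes off under `step`
  -- without a transfinite recursion.
  let W : Type := WType fun a : A => a.1.1
  let ev : W → ι := WType.elim ι step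
  have hA : #A ≤ 𝔠 := by
    simp only [A, mk_prod, lift_id, mk_set, mk_pi, prod_const, mk_nat, two_power_aleph0,
      aleph0_power_aleph0, continuum_mul_self]
    exact (mul_le_mul' le_rfl hT).trans continuum_mul_self.le
  have hW : #W ≤ 𝔠 := by
    refine WType.cardinalMk_le_of_le' ?_
    calc (sum fun a : A => 𝔠 ^ lift.{0} #a.1.1) ≤ sum fun _ : A => 𝔠 := by
          refine sum_le_sum _ _ fun a => ?_
          calc 𝔠 ^ lift.{0} #a.1.1 ≤ 𝔠 ^ ℵ₀ :=
                power_le_power_left continuum_ne_zero (by rw [lift_id]; exact mk_le_aleph0)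
            _ = 𝔠 := continuum_power_aleph0
      _ = #A * 𝔠 := by simp
      _ ≤ 𝔠 := (mul_le_mul' hA le_rfl).trans continuum_mul_self.le
  obtain ⟨b, hb⟩ : ∃ b, b ∉ Set.range ev := by
    by_contra! h
    exact (mk_le_of_surjective (f := ev) h).not_gt (hW.trans_lt hι)
  -- `I` holds the positions where `f b` takes values already used by `M`; `b` itself shows that
  -- this pattern is realised, so `M` contains a realisation `ev v`.
  let I : Set ℕ := {n | ∃ w k, f b n = f (ev w) k}
  have hI : ∀ n : ℕ, ∃ w k, n ∈ I → f b n = f (ev w) k := by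
    intro n
    by_cases h : n ∈ I
    · obtain ⟨w, k, h⟩ := h
      exact ⟨w, k, fun _ => h⟩
    · exact ⟨WType.mk ((∅, id), t b) fun x => x.2.elim, 0, fun h' => (h h').elim⟩
  choose w k hwk using hI
  let v : W := WType.mk ((I, k), t b) fun n => w n
  have hv : t (ev v) = t b ∧ ∀ n : I, f (ev v) n = f (ev (w n)) (k n) := by
    have h : ∃ c, t c = t b ∧ ∀ n : I, f c n = f (ev (w n)) (k n) :=
      ⟨b, rfl, fun n => hwk n n.2⟩
    have hev : ev v = h.choose := by
      change step ⟨((I, k), t b), fun n => ev (w n)⟩ = h.choose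
      exact dif_pos h
    rw [hev]
    exact h.choose_spec
  refine ⟨ev v, b, fun h => hb ⟨v, h⟩, hv.1, fun n m h => ?_⟩
  have hm : m ∈ I := ⟨v, n, h.symm⟩
  exact hf (ev v) (h.trans ((hwk m hm).trans (hv.2 ⟨m, hm⟩).symm))

/-! ### Sets depending on countably many coordinates -/

namespace CantorCube

/-- The coordinate change `x ↦ x ∘ f` between Cantor cubes. -/
def pullback {ι κ : Type} (f : ι → κ) : CantorCube κ →+ CantorCube ι where
  toFun x := fun i => x (f i)
  map_zero' := rfl
  map_add' _ _ := rfl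

theorem continuous_pullback {ι κ : Type} (f : ι → κ) : Continuous (pullback f) :=
  continuous_pi (A := fun _ => ZMod 2) fun i => continuous_apply (A := fun _ => ZMod 2) (f i)

theorem pullback_comp {ι κ ν : Type} (f : ι → κ) (g : κ → ν) :
    pullback (f := g ∘ f) = pullback f ∘ pullback g := rfl

/-- A continuous surjective homomorphism of compact groups carries Haar measure to Haar measure. -/
theorem measurePreserving_pullback {κ : Type} (σ : κ ≃ κ) :
    MeasurePreserving (pullback σ) (lam κ) (lam κ) := by
  refine (pullback σ).measurePreserving (continuous_pullback σ) (fun x => ?_) rfl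
  refine ⟨pullback σ.symm x, ?_⟩
  funext i
  exact congrArg x (σ.symm_apply_apply i)

instance : SecondCountableTopology (CantorCube ℕ) :=
  inferInstanceAs (SecondCountableTopology (ℕ → ZMod 2))

variable {κ : Type}

/-- The set `S` agrees up to a null set with a Borel condition on countably many coordinates. -/
def CountablyDetermined (S : Set (CantorCube κ)) : Prop :=
  ∃ f : ℕ → κ, ∃ B : Set (CantorCube ℕ), MeasurableSet B ∧ S =ᵐ[lam κ] pullback f ⁻¹' B

theorem CountablyDetermined.congr {S T : Set (CantorCube κ)} (hS : CountablyDetermined S)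
    (h : T =ᵐ[lam κ] S) : CountablyDetermined T := by
  obtain ⟨f, B, hB, hSB⟩ := hS
  exact ⟨f, B, hB, h.trans hSB⟩

theorem CountablyDetermined.compl {S : Set (CantorCube κ)} (hS : CountablyDetermined S) :
    CountablyDetermined Sᶜ := by
  obtain ⟨f, B, hB, h⟩ := hS
  exact ⟨f, Bᶜ, hB.compl, ae_eq_set_compl_compl.2 h⟩

/-- Countably many countably determined sets are determined by one sequence of coordinates. -/
theorem exists_common_coordinates {ι : Type} [Countable ι] [Infinite κ]
    {S : ι → Set (CantorCube κ)} (hS : ∀ i, CountablyDetermined (S i)) :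
    ∃ f : ℕ → κ, Function.Injective f ∧ ∀ i, ∃ B : Set (CantorCube ℕ), MeasurableSet B ∧
      S i =ᵐ[lam κ] pullback f ⁻¹' B := by
  choose f B hB hSB using hS
  -- The range of `g` only serves to make `R` infinite, so that a bijection with `ℕ` exists.
  let g : ℕ → κ := Infinite.natEmbedding κ
  let R : Set κ := Set.range g ∪ ⋃ i, Set.range (f i)
  have hRc : R.Countable :=
    (Set.countable_range g).union (Set.countable_iUnion fun i => Set.countable_range _)
  have hRi : R.Infinite :=
    (Set.infinite_range_of_injective (Infinite.natEmbedding κ).injective).mono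
      Set.subset_union_left
  have : Countable R := hRc
  have : Infinite R := hRi.to_subtype
  obtain ⟨e⟩ := nonempty_equiv_of_countable (α := ℕ) (β := R)
  refine ⟨fun n => e n, Subtype.val_injective.comp e.injective, fun i => ?_⟩
  have hmem : ∀ n, f i n ∈ R := fun n => Or.inr (Set.mem_iUnion.2 ⟨i, n, rfl⟩)
  let h : ℕ → ℕ := fun n => e.symm ⟨f i n, hmem n⟩
  have hf : f i = (fun n => (e n : κ)) ∘ h := by
    funext n
    simp [h]
  refine ⟨pullback h ⁻¹' B i, (continuous_pullback h).measurable (hB i), ?_⟩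
  have := hSB i
  rwa [hf, pullback_comp, Set.preimage_comp] at this

theorem CountablyDetermined.iUnion [Infinite κ] {S : ℕ → Set (CantorCube κ)}
    (hS : ∀ i, CountablyDetermined (S i)) : CountablyDetermined (⋃ i, S i) := by
  obtain ⟨f, -, h⟩ := exists_common_coordinates hS
  choose B hB hSB using h
  refine ⟨f, ⋃ i, B i, MeasurableSet.iUnion hB, ?_⟩
  rw [Set.preimage_iUnion]
  exact Filter.EventuallyEq.countable_iUnion hSB

theorem CountablyDetermined.union [Infinite κ] {S T : Set (CantorCube κ)}
    (hS : CountablyDetermined S) (hT : CountablyDetermined T) : CountablyDetermined (S ∪ T) := by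
  obtain ⟨f, -, h⟩ := exists_common_coordinates (S := fun b : Bool => cond b S T)
    (Bool.forall_bool.2 ⟨hT, hS⟩)
  obtain ⟨B, hB, hSB⟩ := h true
  obtain ⟨C, hC, hTC⟩ := h false
  exact ⟨f, B ∪ C, hB.union hC, ae_eq_set_union hSB hTC⟩

theorem countablyDetermined_empty [Infinite κ] : CountablyDetermined (∅ : Set (CantorCube κ)) :=
  ⟨Infinite.natEmbedding κ, ∅, MeasurableSet.empty, Filter.EventuallyEq.rfl⟩

theorem countablyDetermined_coordinate (i : κ) (u : ZMod 2) :
    CountablyDetermined {x : CantorCube κ | x i = u} := by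
  refine ⟨fun _ => i, {y | y 0 = u}, ?_, Filter.EventuallyEq.rfl⟩
  have h : Continuous fun y : CantorCube ℕ => y 0 :=
    continuous_apply (A := fun _ : ℕ => ZMod 2) 0
  exact ((isClosed_discrete {u}).preimage h).measurableSet

theorem countablyDetermined_cylinder [Infinite κ] (s : Finset κ) (e : κ → ZMod 2) :
    CountablyDetermined {x : CantorCube κ | ∀ i ∈ s, x i = e i} := by
  classical
  induction s using Finset.induction_on with
  | empty => simpa using countablyDetermined_empty.compl
  | insert a s _ ih =>
    have := ((countablyDetermined_coordinate a (e a)).compl.union ih.compl).compl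
    convert this using 1
    ext x
    simp

theorem exists_cylinder_subset {U : Set (CantorCube κ)} (hU : IsOpen U) {x : CantorCube κ}
    (hx : x ∈ U) : ∃ s : Finset κ, IsOpen {y : CantorCube κ | ∀ i ∈ s, y i = x i} ∧
      {y : CantorCube κ | ∀ i ∈ s, y i = x i} ⊆ U := by
  obtain ⟨s, u, hu, hs⟩ := isOpen_pi_iff (A := fun _ : κ => ZMod 2).1 hU x hx
  refine ⟨s, ?_, fun y hy => hs fun i hi => ?_⟩
  · have : {y : CantorCube κ | ∀ i ∈ s, y i = x i} = Set.pi (s : Set κ) fun i => {x i} := rfl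
    rw [this]
    exact isOpen_set_pi s.finite_toSet fun i _ => isOpen_discrete _
  · have : y i = x i := hy i hi
    rw [this]
    exact (hu i hi).2

/-- Compactness: finitely many cylinders inside `U` cover `K`. -/
theorem exists_countablyDetermined_between [Infinite κ] {K U : Set (CantorCube κ)}
    (hK : IsCompact K) (hU : IsOpen U) (hKU : K ⊆ U) :
    ∃ E, K ⊆ E ∧ E ⊆ U ∧ CountablyDetermined E := by
  refine hK.induction_on (p := fun K => ∃ E, K ⊆ E ∧ E ⊆ U ∧ CountablyDetermined E) ?_ ?_ ?_ ?_
  · exact ⟨∅, subset_rfl, Set.empty_subset _, countablyDetermined_empty⟩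
  · rintro s t hst ⟨E, h, h'⟩
    exact ⟨E, hst.trans h, h'⟩
  · rintro s t ⟨E, hE, hEU, h⟩ ⟨F, hF, hFU, h'⟩
    exact ⟨E ∪ F, Set.union_subset_union hE hF, Set.union_subset hEU hFU, h.union h'⟩
  · intro x hx
    obtain ⟨s, hs, hsU⟩ := exists_cylinder_subset hU (hKU hx)
    exact ⟨_, mem_nhdsWithin_of_mem_nhds (hs.mem_nhds fun _ _ => rfl), _, subset_rfl, hsU,
      countablyDetermined_cylinder s x⟩

/-- An open set may need uncountably many cylinders, but by inner regularity countably many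
determined subsets exhaust its measure. -/
theorem countablyDetermined_of_isOpen [Infinite κ] {U : Set (CantorCube κ)} (hU : IsOpen U) :
    CountablyDetermined U := by
  obtain hU0 | hU0 := eq_or_ne (lam κ U) 0
  · exact countablyDetermined_empty.congr (ae_eq_empty.2 hU0)
  obtain ⟨u, -, hu, hlim⟩ := exists_seq_strictMono_tendsto' (pos_iff_ne_zero.2 hU0)
  have hE : ∀ n, ∃ E, u n < lam κ E ∧ E ⊆ U ∧ CountablyDetermined E := by
    intro n
    obtain ⟨K, hKU, hK, hn⟩ := hU.exists_lt_isCompact (hu n).2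
    obtain ⟨E, hKE, hEU, h⟩ := exists_countablyDetermined_between hK hU hKU
    exact ⟨E, hn.trans_le (measure_mono hKE), hEU, h⟩
  choose E hn hEU h using hE
  have hU_le : lam κ U ≤ lam κ (⋃ n, E n) :=
    le_of_tendsto' hlim fun n => (hn n).le.trans (measure_mono (Set.subset_iUnion E n))
  have hdet := CountablyDetermined.iUnion h
  obtain ⟨f, B, hB, hEB⟩ := id hdet
  have hnull : NullMeasurableSet (⋃ n, E n) (lam κ) :=
    ((continuous_pullback f).measurable hB).nullMeasurableSet.congr hEB.symm
  exact hdet.congr (ae_eq_of_subset_of_measure_ge (Set.iUnion_subset hEU) hU_le hnull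
    (measure_ne_top _ _)).symm

theorem countablyDetermined_of_measurableSet [Infinite κ] {S : Set (CantorCube κ)}
    (hS : MeasurableSet S) : CountablyDetermined S :=
  MeasurableSpace.generateFrom_induction {s | IsOpen s} (fun s _ => CountablyDetermined s)
    (fun _ h _ => countablyDetermined_of_isOpen h) countablyDetermined_empty
    (fun _ _ => CountablyDetermined.compl) (fun _ _ => CountablyDetermined.iUnion) S hS

end CantorCube

/-! ### Automorphisms induced by involutions -/

namespace MeasureQuotient

variable {X : Type} [MeasurableSpace X] {μ : Measure X}

/-- The preimage map induced by a measure preserving map. -/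
def comap (g : X → X) (hg : MeasurePreserving g μ μ) : MeasureQuotient μ → MeasureQuotient μ :=
  Quotient.map (fun s => ⟨g ⁻¹' s, hg.measurable s.2⟩) fun _ _ h =>
    hg.quasiMeasurePreserving.preimage_ae_eq h

theorem comap_mk (g : X → X) (hg : MeasurePreserving g μ μ)
    (s : {s : Set X // MeasurableSet s}) :
    comap g hg (mk μ s) = mk μ ⟨g ⁻¹' s, hg.measurable s.2⟩ := rfl

theorem monotone_comap (g : X → X) (hg : MeasurePreserving g μ μ) : Monotone (comap g hg) :=
  ind fun _ => ind fun _ => fun h => hg.quasiMeasurePreserving.ae (mk_le_mk.1 h)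

theorem involutive_comap (g : X → X) (hg : MeasurePreserving g μ μ)
    (h : Function.Involutive g) : Function.Involutive (comap g hg) :=
  ind fun s => congrArg (mk μ) (Subtype.ext (by
    change g ∘ g ⁻¹' s.1 = s.1
    rw [h.comp_self, Set.preimage_id]))

end MeasureQuotient

/-- Two injective sequences meeting only at equal indices are swapped by an involution. -/
theorem exists_involutive_swap {κ : Type} {f g : ℕ → κ} (hf : Function.Injective f)
    (hg : Function.Injective g) (h : ∀ n m, f n = g m → n = m) :
    ∃ σ : κ → κ, Function.Involutive σ ∧ σ ∘ f = g ∧ σ ∘ g = f := by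
  classical
  let σ : κ → κ := fun x =>
    if hx : ∃ n, f n = x then g hx.choose else if hx : ∃ n, g n = x then f hx.choose else x
  have hσf : ∀ n, σ (f n) = g n := by
    intro n
    have hx : ∃ m, f m = f n := ⟨n, rfl⟩
    exact (dif_pos hx).trans (congrArg g (hf hx.choose_spec))
  have hσg : ∀ n, σ (g n) = f n := by
    intro n
    -- Where the ranges overlap, `m = n`, so the point is fixed and the two clauses of `σ` agree.
    by_cases hx : ∃ m, f m = g n
    · obtain ⟨m, hm⟩ := hx
      obtain rfl := h m n hm
      rw [← hm, hσf, hm]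
    · have hx' : ∃ m, g m = g n := ⟨n, rfl⟩
      exact (dif_neg hx).trans ((dif_pos hx').trans (congrArg f (hg hx'.choose_spec)))
  refine ⟨σ, fun x => ?_, funext hσf, funext hσg⟩
  by_cases hx : ∃ n, f n = x
  · obtain ⟨n, rfl⟩ := hx
    rw [hσf, hσg]
  by_cases hx' : ∃ n, g n = x
  · obtain ⟨n, rfl⟩ := hx'
    rw [hσg, hσf]
  have : σ x = x := (dif_neg hx).trans (dif_neg hx')
  rw [this, this]

/-- Two families of classes given by the same Borel conditions along two injective sequences of
coordinates meeting only at equal indices are swapped by an automorphism. -/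
theorem exists_orderIso_swap {κ C : Type} {f g : ℕ → κ} (hf : Function.Injective f)
    (hg : Function.Injective g) (h : ∀ n m, f n = g m → n = m)
    {φ ψ : C → MeasureAlg κ} {B : C → {s : Set (CantorCube ℕ) // MeasurableSet s}}
    (hφ : ∀ c, φ c = MeasureQuotient.mk _
      ⟨CantorCube.pullback f ⁻¹' B c, (CantorCube.continuous_pullback f).measurable (B c).2⟩)
    (hψ : ∀ c, ψ c = MeasureQuotient.mk _
      ⟨CantorCube.pullback g ⁻¹' B c, (CantorCube.continuous_pullback g).measurable (B c).2⟩) :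
    ∃ Φ : MeasureAlg κ ≃o MeasureAlg κ, ∀ c, Φ (φ c) = ψ c ∧ Φ (ψ c) = φ c := by
  obtain ⟨σ, hσ, hσf, hσg⟩ := exists_involutive_swap hf hg h
  have hmp := CantorCube.measurePreserving_pullback hσ.toPerm
  have hinv : Function.Involutive (CantorCube.pullback σ) := fun x =>
    funext fun i => congrArg x (hσ i)
  have hcom := MeasureQuotient.involutive_comap _ hmp hinv
  have hmono := MeasureQuotient.monotone_comap _ hmp
  let Φ : MeasureAlg κ ≃o MeasureAlg κ := hcom.toPerm.toOrderIso hmono hmono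
  have hΦ : ∀ c, Φ (φ c) = ψ c := by
    intro c
    rw [hφ, hψ]
    subst hσf
    rfl
  exact ⟨Φ, fun c => ⟨hΦ c, by rw [← hΦ c]; exact hcom (φ c)⟩⟩

/-! ### Coding the homomorphisms, and the conclusion -/

theorem exists_coordinates {κ C : Type} [Infinite κ] [Countable C] (φ : C → MeasureAlg κ) :
    ∃ f : ℕ → κ, Function.Injective f ∧
      ∃ B : C → {s : Set (CantorCube ℕ) // MeasurableSet s}, ∀ c, φ c = MeasureQuotient.mk _
        ⟨CantorCube.pullback f ⁻¹' B c,
          (CantorCube.continuous_pullback f).measurable (B c).2⟩ := by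
  have hrep : ∀ c, ∃ s, MeasureQuotient.mk _ s = φ c := fun c => Quotient.exists_rep (φ c)
  choose S hS using hrep
  obtain ⟨f, hf, h⟩ := CantorCube.exists_common_coordinates fun c =>
    CantorCube.countablyDetermined_of_measurableSet (S c).2
  choose B hB hSB using h
  exact ⟨f, hf, fun c => ⟨B c, hB c⟩, fun c =>
    (hS c).symm.trans (MeasureQuotient.mk_eq_mk.2 (hSB c))⟩

/-- Bounds the number of colours: the Borel σ-algebra of `CantorCube ℕ` is countably generated, and
`𝔠 ^ ℵ₀ = 𝔠`. -/
theorem mk_borel_family_le_continuum (C : Type) [Countable C] :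
    #(C → {s : Set (CantorCube ℕ) // MeasurableSet s}) ≤ 𝔠 := by
  have hB : #{s : Set (CantorCube ℕ) // MeasurableSet s} ≤ 𝔠 := by
    obtain ⟨b, hb, h⟩ := MeasurableSpace.CountablyGenerated.isCountablyGenerated
      (α := CantorCube ℕ)
    have := MeasurableSpace.cardinal_measurableSet_le_continuum
      (s := b) ((le_aleph0_iff_set_countable.2 hb).trans aleph0_le_continuum)
    rw [← h] at this
    exact this
  rw [mk_pi, prod_const, lift_id, lift_id]
  calc _ ≤ 𝔠 ^ #C := power_le_power_right hB
    _ ≤ 𝔠 ^ ℵ₀ := power_le_power_left continuum_ne_zero mk_le_aleph0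
    _ = 𝔠 := continuum_power_aleph0

theorem mainTheorem1 (hGCH : GCH)
    (φ : (Ordinal.omega 2).ToType →
      BoundedLatticeHom CantorAlgebra (MeasureAlg (Ordinal.omega 2).ToType)) :
    ∃ α β : (Ordinal.omega 2).ToType, α < β ∧
      ∃ Φ : MeasureAlg (Ordinal.omega 2).ToType ≃o MeasureAlg (Ordinal.omega 2).ToType,
        ∀ C : CantorAlgebra, Φ (φ α C) = φ β C ∧ Φ (φ β C) = φ α C := by
  have hcard : #(Ordinal.omega.{0} 2).ToType = ℵ_ 2 := by simp
  have : Infinite (Ordinal.omega.{0} 2).ToType :=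
    infinite_iff.2 (hcard ▸ aleph0_le_aleph 2)
  have : Countable CantorAlgebra :=
    TopologicalSpace.Clopens.countable_iff_secondCountable.2 inferInstance
  have hlt : 𝔠 < #(Ordinal.omega.{0} 2).ToType := by
    rw [hcard, ← two_power_aleph0, hGCH ℵ₀ le_rfl, succ_aleph0, aleph_lt_aleph]
    exact one_lt_two
  -- The index set may live in any universe.
  obtain ⟨e⟩ := lift_mk_eq'.1 (show lift #(Ordinal.omega.{0} 2).ToType =
    lift #(Ordinal.omega 2).ToType by simp)
  choose f hf B hB using fun α => exists_coordinates (φ (e α))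
  obtain ⟨α, β, hne, hBB, h⟩ :=
    exists_ne_forall_eq_imp_index_eq hlt (mk_borel_family_le_continuum CantorAlgebra) f hf B
  obtain ⟨Φ, hΦ⟩ := exists_orderIso_swap (hf α) (hf β) h (hB α) (hBB ▸ hB β)
  -- The swap is symmetric, so the pair can be named in increasing order.
  obtain hαβ | hβα := lt_or_gt_of_ne (e.injective.ne hne)
  · exact ⟨e α, e β, hαβ, Φ, hΦ⟩
  · exact ⟨e β, e α, hβα, Φ, fun C => (hΦ C).symm⟩
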